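/- Let $d$ be a natural number, let $\|\cdot\|$ be the operator norm on $M_d(\mathbb{R})$ induced by the Euclidean norm on $\mathbb{R}^d$, and use the conventions $\log 0=-\infty$, $e^{-\infty}=0$. For a Borel measure $\mu$ on $M_d(\mathbb{R})$ and a real number $s>0$ with $\int\|A\|^s\,d\mu(A)<\infty$, the norm pressure is \[\mathbf{M}(\mu,s):=\lim_{n\to\infty}\frac1n\log\int\|A_1\cdots A_n\|^s\,d\mu(A_1)\cdots d\mu(A_n)\in[-\infty,+\infty),\] and for a compact set $\mathsf{A}\subset M_d(\mathbb{R})$ the joint spectral radius is \[\varrho_\infty(\mathsf{A}):=\lim_{n\to\infty}\sup\left\{\|A_1\cdots A_n\|^{1/n}\colon A_1,\ldots,A_n\in\mathsf{A}\right\}\] (with $\sup\emptyset:=0$ if $\mathsf{A}=\emptyset$). Let $\mathsf{A}\subset M_d(\mathbb{R})$ be compact, and let $\mu$ be a finite Borel measure on $M_d(\mathbb{R})$ whose support is equal to $\mathsf{A}$. Then $\int\|A\|^s\,d\mu(A)<\infty$ for every $s>0$, the limits defining $\mathbf{M}(\mu,s)\in[-\infty,+\infty)$ (for every $s>0$) and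 $\varrho_\infty(\mathsf{A})\in[0,\infty)$ exist, and \[\lim_{s\to\infty}e^{\mathbf{M}(\mu,s)/s}=\varrho_\infty(\mathsf{A}).\] -/

import Mathlib

open MeasureTheory Filter Topology
open scoped Matrix.Norms.L2Operator

noncomputable section

namespace MatrixPressure

variable {d : ℕ}

/-- The product `A₁ ⋯ Aₙ` of a finite sequence of matrices, in this order. Here and below, the
norm on `M_d(ℝ)` is the operator norm induced by the Euclidean norm on `ℝ^d`. -/
def orderedProd {n : ℕ} (B : Fin n → Matrix (Fin d) (Fin d) ℝ) : Matrix (Fin d) (Fin d) ℝ :=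
  (List.ofFn B).prod

/-- The integral `∫ ‖A₁ ⋯ Aₙ‖ ^ s dμ(A₁) … dμ(Aₙ) ∈ [0, ∞]`. -/
def normIntegral [MeasurableSpace (Matrix (Fin d) (Fin d) ℝ)]
    (μ : Measure (Matrix (Fin d) (Fin d) ℝ)) (s : ℝ) (n : ℕ) : ENNReal :=
  ∫⁻ B, ENNReal.ofReal (‖orderedProd B‖ ^ s) ∂(Measure.pi fun _ : Fin n => μ)

/-- `(1 / n) log ∫ ‖A₁ ⋯ Aₙ‖ ^ s dμ(A₁) … dμ(Aₙ)`, where `log 0 = -∞` (and `log ∞ = ∞`). -/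
def pressureSeq [MeasurableSpace (Matrix (Fin d) (Fin d) ℝ)]
    (μ : Measure (Matrix (Fin d) (Fin d) ℝ)) (s : ℝ) (n : ℕ) : EReal :=
  ((1 / (n : ℝ) : ℝ) : EReal) * ENNReal.log (normIntegral μ s n)

/-- The norm pressure `M(μ, s)`: the limit of `pressureSeq μ s` in the extended reals. -/
def normPressure [MeasurableSpace (Matrix (Fin d) (Fin d) ℝ)]
    (μ : Measure (Matrix (Fin d) (Fin d) ℝ)) (s : ℝ) : EReal :=
  limUnder atTop (pressureSeq μ s)

/-- `sup {‖A₁ ⋯ Aₙ‖ ^ (1 / n) : Aᵢ ∈ S}`; it is `0` when `S` is empty and `n ≥ 1`. -/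
def jointRadiusSeq (S : Set (Matrix (Fin d) (Fin d) ℝ)) (n : ℕ) : ℝ :=
  sSup {r : ℝ | ∃ B : Fin n → Matrix (Fin d) (Fin d) ℝ,
    (∀ i, B i ∈ S) ∧ r = ‖orderedProd B‖ ^ (1 / (n : ℝ))}

/-- The joint spectral radius of `S`: the limit of `jointRadiusSeq S`. -/
def jointSpectralRadius (S : Set (Matrix (Fin d) (Fin d) ℝ)) : ℝ :=
  limUnder atTop (jointRadiusSeq S)

end MatrixPressure

end

/-! The upper bound is soft: the integral over n-fold products is at most the s-th power of their
largest norm times the n-th power of the total mass, and after an s-th root the mass disappears as s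
→ ∞.

For the lower bound, suppose that e^(M(μ,s)/s) < r < ϱ_∞ with r > 0 fixed and s arbitrarily large.
Then some k satisfies `normIntegral μ s k ≤ r^(sk)`, and a weighted sum of transfer iterates of
‖·‖^s is an s-homogeneous F ≥ ‖·‖^s with `transfer μ F ≤ r^s F` (`exists_transfer_le`). F need not
come from a norm, but an Auerbach argument that uses only homogeneity and F ≥ ‖·‖^s bounds |tr P|^s
by values of F (`exists_abs_trace_rpow_le`). Hence ∫ |tr|^s ≤ (2d)^s d r^(sn), uniformly in k. The
s-th root of the constant stays bounded, so s → ∞ yields the pointwise bound |tr P| ≤ (2d+1) r^n for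
n-fold products from the support.

Finally, traces control joint growth (`le_of_forall_abs_trace_le`): trace pairings determine an
element of the generated algebra modulo its Jacobson radical, and this radical is nilpotent, so it
does not affect the exponential rate. Thus ϱ_∞ ≤ r, a contradiction. -/

open scoped Pointwise

/-! ### Submultiplicative sequences and growth rates -/

/-- Fekete's lemma for submultiplicative sequences in `[0, ∞)`. -/
theorem ENNReal.tendsto_rpow_inv_of_submultiplicative {u : ℕ → ENNReal}
    (hsub : ∀ m n, u (m + n) ≤ u m * u n) (hfin : ∀ n, u n ≠ ⊤) :
    Tendsto (fun n : ℕ => u n ^ (1 / (n : ℝ))) atTop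
      (𝓝 (⨅ n : ℕ, ⨅ _ : n ≠ 0, u n ^ (1 / (n : ℝ)))) := by
  refine tendsto_order.2 ⟨fun a ha => ?_, fun L hL => ?_⟩
  · filter_upwards [eventually_ne_atTop 0] with n hn
    exact ha.trans_le (iInf₂_le n hn)
  · simp only [iInf_lt_iff] at hL
    obtain ⟨n, hn, hL⟩ := hL
    -- A zero term makes all later terms zero; otherwise logarithms reduce the claim to real
    -- subadditive sequences.
    by_cases h0 : ∃ k, u k = 0
    · obtain ⟨k, hk⟩ := h0
      filter_upwards [eventually_ge_atTop k, eventually_ne_atTop 0] with p hp hp0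
      have : u p = 0 := by
        have := hsub k (p - k)
        rw [hk, zero_mul, Nat.add_sub_cancel' hp] at this
        exact le_antisymm this bot_le
      rw [this, ENNReal.zero_rpow_of_pos (by positivity)]
      exact bot_le.trans_lt hL
    · push Not at h0
      have hpos : ∀ k, 0 < (u k).toReal := fun k => ENNReal.toReal_pos (h0 k) (hfin k)
      have key : ∀ k l, Real.log (u (k + l)).toReal ≤
          Real.log (u k).toReal + Real.log (u l).toReal := fun k l => by
        rw [← Real.log_mul (hpos k).ne' (hpos l).ne', ← ENNReal.toReal_mul]
        exact Real.log_le_log (hpos _)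
          (ENNReal.toReal_mono (ENNReal.mul_ne_top (hfin k) (hfin l)) (hsub k l))
      have hlog : ∀ p : ℕ, u p ^ (1 / (p : ℝ)) =
          ENNReal.ofReal (Real.exp (Real.log (u p).toReal / p)) := fun p => by
        rw [div_eq_mul_one_div (Real.log _), ← Real.rpow_def_of_pos (hpos p),
          ← ENNReal.ofReal_rpow_of_pos (hpos p), ENNReal.ofReal_toReal (hfin p)]
      obtain rfl | hLt := eq_or_ne L ⊤
      · exact Eventually.of_forall fun p => by rw [hlog]; exact ENNReal.ofReal_lt_top
      have hL0 : 0 < L.toReal := ENNReal.toReal_pos (bot_le.trans_lt hL).ne' hLt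
      have aux : ∀ p : ℕ, u p ^ (1 / (p : ℝ)) < L ↔
          Real.log (u p).toReal / p < Real.log L.toReal := fun p => by
        rw [hlog, Real.lt_log_iff_exp_lt hL0]
        exact ENNReal.ofReal_lt_iff_lt_toReal (Real.exp_pos _).le hLt
      -- This half of Fekete's lemma needs no lower bound, so an infimum of -∞ for the logarithms is
      -- harmless.
      have := Subadditive.eventually_div_lt_of_div_lt
        (u := fun k => Real.log (u k).toReal) key hn ((aux n).1 hL)
      filter_upwards [this] with p hp using (aux p).2 hp

/-- If `x ^ k ≤ c * y ^ k` for all positive `k`, then `x ≤ y`. -/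
theorem le_of_forall_pow_le_const_mul_pow {x y c : ℝ} (hy : 0 < y)
    (h : ∀ k : ℕ, k ≠ 0 → x ^ k ≤ c * y ^ k) : x ≤ y := by
  by_contra! hlt
  have : Tendsto (fun k : ℕ => (x / y) ^ k) atTop atTop :=
    tendsto_pow_atTop_atTop_of_one_lt ((one_lt_div hy).2 hlt)
  obtain ⟨k, hk, hk0⟩ := ((this.eventually_gt_atTop c).and (eventually_ne_atTop 0)).exists
  rw [div_pow, lt_div_iff₀ (by positivity)] at hk
  exact (h k hk0).not_gt hk

/-! ### Traces and the Jacobson radical -/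

/-- In characteristic zero the trace of an idempotent is its rank. -/
theorem Matrix.eq_zero_of_isIdempotentElem_of_trace_eq_zero {d : ℕ}
    {e : Matrix (Fin d) (Fin d) ℝ} (he : IsIdempotentElem e) (h : e.trace = 0) : e = 0 := by
  have h1 : IsIdempotentElem (Matrix.toLin' e) := by
    unfold IsIdempotentElem
    rw [Module.End.mul_eq_comp, ← Matrix.toLin'_mul, he.eq]
  have := LinearMap.IsIdempotentElem.eq_zero_of_trace_eq_zero h1 (by rwa [Matrix.trace_toLin'_eq])
  simpa using this

open Polynomial in
/-- A real matrix `a` with `tr (a p(a)) = 0` for every polynomial `p` is nilpotent. -/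
theorem Matrix.isNilpotent_of_trace_mul_aeval_eq_zero {d : ℕ} {a : Matrix (Fin d) (Fin d) ℝ}
    (h : ∀ p : ℝ[X], (a * aeval a p).trace = 0) : IsNilpotent a := by
  obtain ⟨g, hg, hXg⟩ := (Polynomial.finiteMultiplicity_of_degree_pos_of_monic (p := X)
    (by simp) monic_X (Matrix.charpoly_monic a).ne_zero).exists_eq_pow_mul_and_not_dvd
  set k := multiplicity X a.charpoly
  -- With charpoly = X^k g and X ∤ g, the Bézout term u X^(k+1) evaluates at `a` to the projection
  -- onto the part where `a` is invertible. The exponent k + 1 makes it divisible by X even if k =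
  -- 0, so the trace hypothesis applies and the projection vanishes.
  obtain ⟨u, v, huv⟩ : IsCoprime (X ^ (k + 1)) g :=
    ((irreducible_X.coprime_iff_not_dvd).2 hXg).pow_left
  have hχ : aeval a (X ^ (k + 1) * g) = 0 := by
    rw [pow_succ', mul_assoc, ← hg, map_mul, Matrix.aeval_self_charpoly, mul_zero]
  have he : aeval a (u * X ^ (k + 1)) = 0 := by
    apply Matrix.eq_zero_of_isIdempotentElem_of_trace_eq_zero
    · have : (u * X ^ (k + 1)) * (u * X ^ (k + 1)) =
          u * X ^ (k + 1) - u * v * (X ^ (k + 1) * g) := by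
        linear_combination (u * X ^ (k + 1)) * huv
      rw [IsIdempotentElem, ← map_mul, this, map_sub, map_mul _ (u * v), hχ, mul_zero, sub_zero]
    · have : u * X ^ (k + 1) = X * (X ^ k * u) := by ring
      rw [this, map_mul, aeval_X]
      exact h _
  refine ⟨k + 1, ?_⟩
  have : (X : ℝ[X]) ^ (k + 1) = X ^ (k + 1) * (u * X ^ (k + 1)) + v * (X ^ (k + 1) * g) := by
    linear_combination -X ^ (k + 1) * huv
  have := congrArg (aeval a) this
  rwa [map_add, map_mul _ _ (u * _), map_mul _ v, hχ, he, mul_zero, mul_zero, add_zero, map_pow,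
    aeval_X] at this

/-- Elements of the radical of the trace form of a matrix algebra lie in the Jacobson radical. -/
theorem Subalgebra.mem_jacobson_of_trace_mul_eq_zero {d : ℕ}
    {R : Subalgebra ℝ (Matrix (Fin d) (Fin d) ℝ)} {a : R}
    (h : ∀ b : R, Matrix.trace ((a : Matrix (Fin d) (Fin d) ℝ) * (b : Matrix (Fin d) (Fin d) ℝ)) = 0) :
    a ∈ Ring.jacobson R := by
  rw [← Ideal.jacobson_bot, Ideal.mem_jacobson_iff]
  intro y
  -- Cyclicity of the trace turns tr (ya p(ya)) into tr (a · p(ya) y), which vanishes by hypothesis.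
  have hnil : IsNilpotent (y * a) := by
    rw [← IsNilpotent.map_iff (f := R.val) Subtype.val_injective]
    refine Matrix.isNilpotent_of_trace_mul_aeval_eq_zero fun p => ?_
    have := h (Polynomial.aeval (y * a) p * y)
    rw [← Subalgebra.coe_val, ← map_mul, ← mul_assoc, map_mul,
      Matrix.trace_mul_comm, ← map_mul, ← mul_assoc] at this
    rwa [Polynomial.aeval_algHom_apply, ← map_mul]
  obtain ⟨z, hz⟩ := hnil.isUnit_add_one.exists_left_inv
  refine ⟨z, ?_⟩
  rw [mul_add, mul_one, ← mul_assoc] at hz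
  simp [hz]

/-! ### Growth of products modulo a nilpotent ideal -/

/-- Products of elements `S + ν`, where `S` has norm at most `α` and `ν` is an element of norm at
most `β` of a nilpotent ideal, grow at rate at most `α + t β` for every `t > 0`. -/
theorem exists_forall_pow_norm_le {R : Type*} [NormedRing R] {J : Ideal R} [J.IsTwoSided] {K : ℕ}
    (hJ : J ^ K = ⊥) {α β t : ℝ} (hα : 0 ≤ α) (hβ : 0 ≤ β) (ht : 0 < t) :
    ∃ c : ℝ, ∀ s : Set R, (∀ P ∈ s, ∃ ν ∈ J, ‖ν‖ ≤ β ∧ ‖P - ν‖ ≤ α) →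
      ∀ k : ℕ, ∀ Q ∈ s ^ k, ‖Q‖ ≤ c * (α + t * β) ^ k := by
  refine ⟨∑ j ∈ Finset.range K, ‖(1 : R)‖ * t⁻¹ ^ j, fun s hs k Q hQ => ?_⟩
  -- Expand each factor as (P - ν) + ν; T j collects the terms with exactly j factors ν. It lies in
  -- J^j, and its norm is controlled by the j-th term of (α + tβ)^k after division by t^j.
  have key : ∃ T : ℕ → R, (∀ j, T j ∈ J ^ j) ∧
      (∀ j, ‖T j‖ ≤ ‖(1 : R)‖ * t⁻¹ ^ j * (α + t * β) ^ k) ∧ Q = ∑ j ∈ Finset.range K, T j := by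
    induction k generalizing Q with
    | zero =>
      refine ⟨fun j => if j = 0 then 1 else 0, fun j => ?_, fun j => ?_, ?_⟩
      · by_cases hj : j = 0
        · simp [hj, Submodule.pow_zero, Ideal.one_eq_top]
        · simp [hj]
      · by_cases hj : j = 0
        · simp [hj]
        · simp only [hj, if_false, norm_zero]; positivity
      · rw [pow_zero, Set.mem_one] at hQ
        rw [hQ, Finset.sum_ite_eq']
        by_cases hK : K = 0
        · subst hK
          have : (1 : R) ∈ (⊥ : Ideal R) := by
            rw [← hJ, Submodule.pow_zero, Ideal.one_eq_top]; trivial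
          simpa using this
        · simp [Nat.pos_of_ne_zero hK]
    | succ k ih =>
      rw [pow_succ', Set.mem_mul] at hQ
      obtain ⟨P, hP, Q', hQ', rfl⟩ := hQ
      obtain ⟨T, hT, hTn, hsum⟩ := ih Q' hQ'
      obtain ⟨ν, hν, hνβ, hα'⟩ := hs P hP
      refine ⟨fun j => (P - ν) * T j + (if j = 0 then 0 else ν * T (j - 1)),
        fun j => ?_, fun j => ?_, ?_⟩
      · refine add_mem (Ideal.mul_mem_left _ _ (hT j)) ?_
        rcases j with _ | j
        · simp
        · simpa [Ideal.IsTwoSided.pow_succ] using Ideal.mul_mem_mul hν (hT j)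
      · have hA : ‖(P - ν) * T j‖ ≤ α * (‖(1 : R)‖ * t⁻¹ ^ j * (α + t * β) ^ k) :=
          (norm_mul_le _ _).trans (mul_le_mul hα' (hTn j) (norm_nonneg _) hα)
        have hB : ‖(if j = 0 then 0 else ν * T (j - 1))‖ ≤
            t * β * (‖(1 : R)‖ * t⁻¹ ^ j * (α + t * β) ^ k) := by
          rcases j with _ | j
          · simp only [if_true, norm_zero]; positivity
          · simp only [Nat.succ_ne_zero, if_false, Nat.add_sub_cancel]
            calc _ ≤ β * (‖(1 : R)‖ * t⁻¹ ^ j * (α + t * β) ^ k) :=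
                  (norm_mul_le _ _).trans (mul_le_mul hνβ (hTn j) (norm_nonneg _) hβ)
              _ = _ := by rw [pow_succ]; field_simp
        calc _ ≤ _ := norm_add_le _ _
          _ ≤ _ := add_le_add hA hB
          _ = _ := by ring
      · have h0 : ν * T (K - 1) = 0 ∨ K = 0 := by
          rcases K with _ | K
          · simp
          · left
            have := Ideal.mul_mem_mul hν (hT K)
            rw [← Ideal.IsTwoSided.pow_succ, hJ] at this
            simpa using this
        rw [Finset.sum_add_distrib, ← Finset.mul_sum, ← hsum, sub_mul, sub_eq_add_neg, add_assoc,
          left_eq_add, neg_add_eq_zero, hsum, Finset.mul_sum]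
        rcases K with _ | K
        · simp
        · rw [Finset.sum_range_succ, Finset.sum_range_succ']
          simp only [Nat.add_sub_cancel, Nat.add_one_ne_zero, or_false] at h0
          simp [h0]
  obtain ⟨T, -, hT, rfl⟩ := key
  rw [Finset.sum_mul]
  exact (norm_sum_le _ _).trans (Finset.sum_le_sum fun j _ => hT j)

theorem Submonoid.exists_mem_pow_of_mem_closure {M : Type*} [Monoid M] {A : Set M} {w : M}
    (hw : w ∈ Submonoid.closure A) : ∃ k : ℕ, w ∈ A ^ k := by
  induction hw using Submonoid.closure_induction with
  | mem x hx => exact ⟨1, by simpa using hx⟩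
  | one => exact ⟨0, by simp⟩
  | mul x y _ _ hx hy =>
    obtain ⟨k, hk⟩ := hx
    obtain ⟨l, hl⟩ := hy
    exact ⟨k + l, by rw [pow_add]; exact Set.mul_mem_mul hk hl⟩

/-- If traces of products of `n` elements of `A` are bounded by `C r ^ n`, then these products are
bounded by `C' r ^ n` modulo the Jacobson radical of the algebra generated by `A`. -/
theorem exists_norm_sub_jacobson_le {d : ℕ} {A : Set (Matrix (Fin d) (Fin d) ℝ)} {C r : ℝ}
    (htr : ∀ n : ℕ, ∀ P ∈ A ^ n, |P.trace| ≤ C * r ^ n) (hr : 0 < r) :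
    ∃ C' : ℝ, 0 < C' ∧ ∀ n : ℕ, ∀ P : Algebra.adjoin ℝ A, (P : Matrix (Fin d) (Fin d) ℝ) ∈ A ^ n →
      ∃ ν ∈ Ring.jacobson (Algebra.adjoin ℝ A), ‖P - ν‖ ≤ C' * r ^ n := by
  set R := Algebra.adjoin ℝ A with hR
  -- If w is a product of k generators, P w is a product of n + k of them; the general case is
  -- linear in w.
  have hD : ∀ w ∈ R, ∃ D : ℝ, ∀ n : ℕ, ∀ P ∈ A ^ n, |(P * w).trace| ≤ D * r ^ n := by
    intro w hw
    rw [← Subalgebra.mem_toSubmodule, Algebra.adjoin_eq_span] at hw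
    induction hw using Submodule.span_induction with
    | mem w hw =>
      obtain ⟨k, hk⟩ := Submonoid.exists_mem_pow_of_mem_closure hw
      refine ⟨C * r ^ k, fun n P hP => ?_⟩
      have := htr (n + k) (P * w) (by rw [pow_add]; exact Set.mul_mem_mul hP hk)
      rwa [pow_add, mul_comm (r ^ n), ← mul_assoc] at this
    | zero => exact ⟨0, by simp⟩
    | add x y _ _ hx hy =>
      obtain ⟨D, hD⟩ := hx
      obtain ⟨D', hD'⟩ := hy
      refine ⟨D + D', fun n P hP => ?_⟩
      rw [mul_add, Matrix.trace_add, add_mul]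
      exact (abs_add_le _ _).trans (add_le_add (hD n P hP) (hD' n P hP))
    | smul c x _ hx =>
      obtain ⟨D, hD⟩ := hx
      refine ⟨|c| * D, fun n P hP => ?_⟩
      rw [Matrix.mul_smul, Matrix.trace_smul, smul_eq_mul, abs_mul, mul_assoc]
      exact mul_le_mul_of_nonneg_left (hD n P hP) (abs_nonneg c)
  let w := Module.finBasis ℝ R
  choose D hD using fun i => hD (w i) (w i).2
  let ψ : R →ₗ[ℝ] (Fin (Module.finrank ℝ R) → ℝ) := LinearMap.pi fun i =>
    Matrix.traceLinearMap (Fin d) ℝ ℝ ∘ₗ LinearMap.mulRight ℝ (w i : Matrix (Fin d) (Fin d) ℝ) ∘ₗ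
      R.val.toLinearMap
  have hψ : ∀ P i, ψ P i = ((P : Matrix (Fin d) (Fin d) ℝ) * w i).trace := fun P i => rfl
  -- σ lifts trace vectors linearly to R. Thus P - σ(ψ P) has zero trace pairings and lies in the
  -- radical, while σ(ψ P) is as small as the traces.
  obtain ⟨σ, hσ⟩ := ψ.rangeRestrict.exists_rightInverse_of_surjective ψ.range_rangeRestrict
  let D' := ∑ i, |D i|
  refine ⟨‖LinearMap.toContinuousLinearMap (R.val.toLinearMap ∘ₗ σ)‖ * D' + 1, by positivity, fun n P hP =>
    ⟨P - σ (ψ.rangeRestrict P), ?_, ?_⟩⟩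
  · apply Subalgebra.mem_jacobson_of_trace_mul_eq_zero
    set ν := P - σ (ψ.rangeRestrict P) with hν
    have h0 : ψ ν = 0 := by
      have := congrArg Subtype.val (LinearMap.congr_fun hσ (ψ.rangeRestrict P))
      change ψ (σ (ψ.rangeRestrict P)) = ψ P at this
      rw [hν, map_sub, this, sub_self]
    let φ : R →ₗ[ℝ] ℝ := Matrix.traceLinearMap (Fin d) ℝ ℝ ∘ₗ
      LinearMap.mulLeft ℝ (ν : Matrix (Fin d) (Fin d) ℝ) ∘ₗ R.val.toLinearMap
    have : φ = 0 := w.ext fun i => congrFun h0 i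
    exact fun b => LinearMap.congr_fun this b
  · rw [sub_sub_cancel]
    have h1 : ‖ψ.rangeRestrict P‖ ≤ D' * r ^ n := by
      change ‖ψ P‖ ≤ _
      refine (pi_norm_le_iff_of_nonneg (by positivity)).2 fun i => ?_
      rw [hψ, Real.norm_eq_abs]
      refine (hD i n P hP).trans (mul_le_mul_of_nonneg_right ?_ (by positivity))
      exact (le_abs_self _).trans
        (Finset.single_le_sum (f := fun i => |D i|) (fun i _ => abs_nonneg _) (Finset.mem_univ i))
    calc ‖σ (ψ.rangeRestrict P)‖
        ≤ ‖LinearMap.toContinuousLinearMap (R.val.toLinearMap ∘ₗ σ)‖ * ‖ψ.rangeRestrict P‖ :=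
          (LinearMap.toContinuousLinearMap (R.val.toLinearMap ∘ₗ σ)).le_opNorm _
      _ ≤ ‖LinearMap.toContinuousLinearMap (R.val.toLinearMap ∘ₗ σ)‖ * (D' * r ^ n) := by gcongr
      _ ≤ _ := by rw [add_mul, mul_assoc]; linarith [pow_pos hr n]

/-- If traces of products of `n` elements of a bounded set `A` are bounded by `C r ^ n`, then the
exponential growth rate of the norms of these products is at most `r`. -/
theorem le_of_forall_abs_trace_le {d : ℕ} {A : Set (Matrix (Fin d) (Fin d) ℝ)} {C r ρ : ℝ}
    (htr : ∀ n : ℕ, ∀ P ∈ A ^ n, |P.trace| ≤ C * r ^ n) (hr : 0 < r)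
    (hbdd : ∀ n : ℕ, ∃ M, ∀ P ∈ A ^ n, ‖P‖ ≤ M)
    (hρ : ∀ n : ℕ, n ≠ 0 → ∀ c : ℝ, 0 ≤ c → (∀ P ∈ A ^ n, ‖P‖ ≤ c) → ρ ^ n ≤ c) : ρ ≤ r := by
  obtain ⟨C', hC', hdec⟩ := exists_norm_sub_jacobson_le htr hr
  set R := Algebra.adjoin ℝ A with hR
  have : IsArtinianRing R := IsArtinianRing.of_finite ℝ R
  obtain ⟨K, hK⟩ := IsSemiprimaryRing.isNilpotent (R := R)
  -- Two limits: for blocks of fixed length m, the number k of blocks tends to infinity, giving ρ^m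
  -- ≤ 2 C' r^m; then m tends to infinity. The constant `c` below may depend on m.
  refine le_of_forall_pow_le_const_mul_pow (c := 2 * C') hr fun m hm => ?_
  obtain ⟨M, hM⟩ := hbdd m
  set α := C' * r ^ m
  have hα : 0 < α := by positivity
  set β := |M| + α
  have hβ : 0 < β := by positivity
  -- The weight t = α / β makes α + tβ equal to 2α, however large the radical parts are.
  have ht : 0 < α / β := by positivity
  obtain ⟨c, hc⟩ := exists_forall_pow_norm_le hK hα.le hβ.le ht
  rw [div_mul_cancel₀ _ hβ.ne'] at hc
  have hsub : A ⊆ R := Algebra.subset_adjoin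
  have himg : R.val '' (R.val ⁻¹' (A ^ m)) = A ^ m := by
    rw [Set.image_preimage_eq_iff]
    intro P hP
    have hle : A ^ m ⊆ (R.toSubmonoid : Set (Matrix (Fin d) (Fin d) ℝ)) := Submonoid.pow_subset hsub
    exact ⟨⟨P, hle hP⟩, rfl⟩
  rw [mul_assoc, two_mul]
  refine le_of_forall_pow_le_const_mul_pow (c := |c|) (by positivity) fun k hk => ?_
  rw [← pow_mul]
  refine hρ (m * k) (mul_ne_zero hm hk) _ (by positivity) fun P hP => ?_
  rw [pow_mul, ← himg, ← Set.image_pow] at hP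
  obtain ⟨Q, hQ, rfl⟩ := hP
  refine (hc _ (fun P hP => ?_) k Q hQ).trans
    (mul_le_mul_of_nonneg_right (le_abs_self c) (by positivity))
  obtain ⟨ν, hν, hPν⟩ := hdec m P hP
  refine ⟨ν, hν, ?_, hPν⟩
  calc ‖ν‖ = ‖P - (P - ν)‖ := by rw [sub_sub_cancel]
    _ ≤ ‖P‖ + ‖P - ν‖ := norm_sub_le _ _
    _ ≤ |M| + α := add_le_add ((hM P hP).trans (le_abs_self M)) hPν

/-! ### An Auerbach bound for traces -/

/-- Since det V · P = P V adj V, the left side is the trace of adj V · (P V), whose diagonal entries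
are Cramer determinants. -/
theorem Matrix.trace_mul_det_eq_sum_det_updateCol {ι : Type*} [Fintype ι] [DecidableEq ι]
    (P V : Matrix ι ι ℝ) :
    P.trace * V.det = ∑ i, (V.updateCol i (P.mulVec (V.col i))).det := by
  have h : V.det • P = P * V * V.adjugate := by
    rw [Matrix.mul_assoc, Matrix.mul_adjugate, Matrix.mul_smul, Matrix.mul_one]
  have h2 := congrArg Matrix.trace h
  rw [Matrix.trace_smul, Matrix.trace_mul_comm, smul_eq_mul, mul_comm] at h2
  rw [h2, Matrix.trace]
  refine Finset.sum_congr rfl fun i _ => ?_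
  rw [← Matrix.cramer_apply, Matrix.cramer_eq_adjugate_mulVec]
  rfl

/-- An Auerbach-type trace bound: for a positive function `φ` on `ℝ^d` which is homogeneous of
degree `s`, the trace of a matrix is controlled by the values of `φ` at the images of suitable
vectors in `{φ ≤ 1}`, with a constant that depends only on `d`. -/
theorem exists_abs_trace_rpow_le {d : ℕ} {s : ℝ} (hs : 0 < s) {φ : (Fin d → ℝ) → ℝ}
    (hhom : ∀ (c : ℝ) x, φ (c • x) = |c| ^ s * φ x) (hφ : ∀ x, ‖x‖ ^ s ≤ φ x) :
    ∃ V : Fin d → Fin d → ℝ, (∀ i, φ (V i) ≤ 1) ∧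
      ∀ P : Matrix (Fin d) (Fin d) ℝ, |P.trace| ^ s ≤ (2 * d) ^ s * ∑ i, φ (P.mulVec (V i)) := by
  have hφ0 : ∀ x, 0 ≤ φ x := fun x => (by positivity : 0 ≤ ‖x‖ ^ s).trans (hφ x)
  set S : Set ℝ := {D | ∃ V : Matrix (Fin d) (Fin d) ℝ, (∀ i, φ (V.col i) ≤ 1) ∧ |V.det| = D}
  have hSbdd : BddAbove S := by
    refine ⟨(Fintype.card (Fin d)).factorial • (1 : ℝ) ^ Fintype.card (Fin d), ?_⟩
    rintro _ ⟨V, hV, rfl⟩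
    refine Matrix.det_le (abv := AbsoluteValue.abs) fun i j => ?_
    have h1 : ‖V.col j‖ ^ s ≤ 1 ^ s := by rw [Real.one_rpow]; exact (hφ _).trans (hV j)
    exact (norm_le_pi_norm (V.col j) i).trans
      ((Real.rpow_le_rpow_iff (norm_nonneg _) zero_le_one hs).1 h1)
  obtain ⟨D, hDS, hD⟩ : ∃ D ∈ S, 0 < D := by
    set q := 1 + ∑ i, φ ((1 : Matrix (Fin d) (Fin d) ℝ).col i)
    have hq : 0 < q := by
      have := Finset.sum_nonneg fun i (_ : i ∈ Finset.univ) =>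
        hφ0 ((1 : Matrix (Fin d) (Fin d) ℝ).col i)
      positivity
    have hc : 0 < q⁻¹ ^ s⁻¹ := by positivity
    refine ⟨_, ⟨(q⁻¹ ^ s⁻¹) • 1, fun i => ?_, rfl⟩, ?_⟩
    · have : ((q⁻¹ ^ s⁻¹) • (1 : Matrix (Fin d) (Fin d) ℝ)).col i =
          (q⁻¹ ^ s⁻¹) • (1 : Matrix (Fin d) (Fin d) ℝ).col i := rfl
      rw [this, hhom, abs_of_pos hc, Real.rpow_inv_rpow (by positivity) hs.ne',
        inv_mul_le_iff₀ hq, mul_one]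
      have := Finset.single_le_sum (f := fun i => φ ((1 : Matrix (Fin d) (Fin d) ℝ).col i))
        (fun i _ => hφ0 _) (Finset.mem_univ i)
      simp only [q]
      linarith
    · rw [Matrix.det_smul, Matrix.det_one, mul_one]
      positivity
  have hsup : 0 < sSup S := hD.trans_le (le_csSup hSbdd hDS)
  -- φ is not assumed continuous, so a maximal determinant may not exist; one above half the
  -- supremum suffices and costs the factor 2.
  obtain ⟨_, ⟨V, hV, rfl⟩, hVdet⟩ := exists_lt_of_lt_csSup ⟨D, hDS⟩ (half_lt_self hsup)
  have hdet : 0 < |V.det| := (half_pos hsup).trans hVdet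
  -- Replacing a column by y scaled to φ = 1 gives a competitor for the supremum; if φ y = 0 then y
  -- = 0.
  have hupd : ∀ i y, |(V.updateCol i y).det| ≤ sSup S * φ y ^ s⁻¹ := by
    intro i y
    obtain h0 | hpos := (hφ0 y).eq_or_lt
    · have hy : y = 0 := by
        by_contra hy
        have : 0 < ‖y‖ ^ s := Real.rpow_pos_of_pos (norm_pos_iff.2 hy) s
        exact (this.trans_le (hφ y)).ne h0
      rw [← Matrix.cramer_apply, hy, map_zero, Pi.zero_apply, abs_zero]
      exact mul_nonneg hsup.le (Real.rpow_nonneg (hφ0 _) _)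
    · have hy : 0 < φ y ^ s⁻¹ := by positivity
      have hmem : |(V.updateCol i ((φ y ^ s⁻¹)⁻¹ • y)).det| ∈ S := by
        refine ⟨_, fun j => ?_, rfl⟩
        by_cases hj : j = i
        · subst hj
          have : (V.updateCol j ((φ y ^ s⁻¹)⁻¹ • y)).col j = (φ y ^ s⁻¹)⁻¹ • y := by
            ext k; simp [Matrix.col]
          rw [this, hhom, abs_of_pos (by positivity), Real.inv_rpow hy.le,
            Real.rpow_inv_rpow hpos.le hs.ne', inv_mul_cancel₀ hpos.ne']
        · have : (V.updateCol i ((φ y ^ s⁻¹)⁻¹ • y)).col j = V.col j := by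
            ext k; simp [Matrix.col, hj]
          rw [this]
          exact hV j
      have := le_csSup hSbdd hmem
      rwa [Matrix.det_updateCol_smul, abs_mul, abs_of_pos (inv_pos.2 hy), inv_mul_le_iff₀ hy,
        mul_comm] at this
  refine ⟨fun i => V.col i, hV, fun P => ?_⟩
  set m := ∑ i, φ (P.mulVec (V.col i))
  have hm : 0 ≤ m := Finset.sum_nonneg fun i _ => hφ0 _
  have hle : |P.trace| ≤ 2 * d * m ^ s⁻¹ := by
    have h1 : |P.trace| * |V.det| ≤ d * (sSup S * m ^ s⁻¹) := by
      rw [← abs_mul, Matrix.trace_mul_det_eq_sum_det_updateCol]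
      refine (Finset.abs_sum_le_sum_abs _ _).trans ?_
      refine (Finset.sum_le_card_nsmul _ _ (sSup S * m ^ s⁻¹) fun i _ => ?_).trans_eq (by simp)
      refine (hupd i _).trans (mul_le_mul_of_nonneg_left ?_ hsup.le)
      exact Real.rpow_le_rpow (hφ0 _) (Finset.single_le_sum
        (f := fun i => φ (P.mulVec (V.col i))) (fun i _ => hφ0 _) (Finset.mem_univ i))
        (by positivity)
    have h2 : d * (sSup S * m ^ s⁻¹) ≤ 2 * d * m ^ s⁻¹ * |V.det| := by
      have : sSup S ≤ 2 * |V.det| := by linarith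
      calc d * (sSup S * m ^ s⁻¹) ≤ d * (2 * |V.det| * m ^ s⁻¹) := by gcongr
        _ = _ := by ring
    exact le_of_mul_le_mul_right (h1.trans h2) hdet
  calc |P.trace| ^ s ≤ (2 * d * m ^ s⁻¹) ^ s := by gcongr
    _ = _ := by rw [Real.mul_rpow (by positivity) (by positivity), Real.rpow_inv_rpow hm hs.ne']

theorem Matrix.abs_apply_le_l2_opNorm {d : ℕ} (X : Matrix (Fin d) (Fin d) ℝ) (i j : Fin d) :
    |X i j| ≤ ‖X‖ := by
  have h := Matrix.l2_opNorm_mulVec X (EuclideanSpace.single j 1)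
  rw [PiLp.norm_single, norm_one, mul_one] at h
  have h2 := (PiLp.norm_apply_le _ i).trans h
  simpa using h2

/-- Vectors are encoded as matrices with equal columns, so that functions of matrices can serve as
the φ of the trace bound. -/
theorem Matrix.norm_le_norm_replicateCol {d : ℕ} (x : Fin d → ℝ) :
    ‖x‖ ≤ ‖Matrix.replicateCol (Fin d) x‖ :=
  (pi_norm_le_iff_of_nonneg (norm_nonneg _)).2 fun i =>
    Matrix.abs_apply_le_l2_opNorm (Matrix.replicateCol (Fin d) x) i i

/-! ### The transfer operator -/

namespace MatrixPressure

variable {d : ℕ}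

theorem orderedProd_cons {n : ℕ} (A : Matrix (Fin d) (Fin d) ℝ)
    (B : Fin n → Matrix (Fin d) (Fin d) ℝ) :
    orderedProd (Fin.cons A B : Fin (n + 1) → _) = A * orderedProd B := by
  simp [orderedProd, List.ofFn_succ]

theorem orderedProd_succ {n : ℕ} (B : Fin (n + 1) → Matrix (Fin d) (Fin d) ℝ) :
    orderedProd B = B 0 * orderedProd (fun i => B i.succ) := by
  simp [orderedProd, List.ofFn_succ]

instance secondCountableTopology_matrix : SecondCountableTopology (Matrix (Fin d) (Fin d) ℝ) :=
  inferInstanceAs (SecondCountableTopology (Fin d → Fin d → ℝ))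

theorem continuous_orderedProd (n : ℕ) :
    Continuous (orderedProd : (Fin n → Matrix (Fin d) (Fin d) ℝ) → _) := by
  induction n with
  | zero => exact continuous_of_const fun _ _ => by simp [orderedProd]
  | succ n ih =>
    simp only [funext orderedProd_succ]
    exact (continuous_apply 0).mul (ih.comp (by fun_prop))

variable [MeasurableSpace (Matrix (Fin d) (Fin d) ℝ)]

/-- The operator `f ↦ (X ↦ ∫ f (A X) dμ(A))`. -/
noncomputable def transfer (μ : Measure (Matrix (Fin d) (Fin d) ℝ))
    (f : Matrix (Fin d) (Fin d) ℝ → ENNReal) (X : Matrix (Fin d) (Fin d) ℝ) : ENNReal :=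
  ∫⁻ A, f (A * X) ∂μ

variable {μ : Measure (Matrix (Fin d) (Fin d) ℝ)} {f : Matrix (Fin d) (Fin d) ℝ → ENNReal}

theorem transfer_mono {f g : Matrix (Fin d) (Fin d) ℝ → ENNReal} (h : f ≤ g) :
    transfer μ f ≤ transfer μ g :=
  fun _ => lintegral_mono fun _ => h _

theorem iterate_transfer_smul {c : ℝ} {k : ENNReal} (hk : k ≠ ⊤) (n : ℕ)
    (hf : ∀ X, f (c • X) = k * f X) (X : Matrix (Fin d) (Fin d) ℝ) :
    (transfer μ)^[n] f (c • X) = k * (transfer μ)^[n] f X := by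
  induction n generalizing X with
  | zero => exact hf X
  | succ n ih =>
    simp only [Function.iterate_succ_apply', transfer, Matrix.mul_smul, ih]
    exact lintegral_const_mul' _ _ hk

theorem iterate_transfer_le_of_transfer_le {c : ENNReal} (hc : c ≠ ⊤)
    (h : ∀ X, transfer μ f X ≤ c * f X) (n : ℕ) (X : Matrix (Fin d) (Fin d) ℝ) :
    (transfer μ)^[n] f X ≤ c ^ n * f X := by
  induction n generalizing X with
  | zero => simp
  | succ n ih =>
    rw [Function.iterate_succ_apply']
    refine (transfer_mono ih X).trans ?_
    simp only [transfer]
    rw [lintegral_const_mul' _ _ (by finiteness), pow_succ, mul_assoc]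
    exact mul_le_mul_right (h X) _

variable [BorelSpace (Matrix (Fin d) (Fin d) ℝ)]

theorem measurable_orderedProd (n : ℕ) :
    Measurable (orderedProd : (Fin n → Matrix (Fin d) (Fin d) ℝ) → _) := by
  exact (continuous_orderedProd n).measurable

theorem measurable_transfer [SFinite μ] (hf : Measurable f) : Measurable (transfer μ f) :=
  (hf.comp (measurable_snd.mul measurable_fst)).lintegral_prod_right'

theorem measurable_iterate_transfer [SFinite μ] (hf : Measurable f) (n : ℕ) :
    Measurable ((transfer μ)^[n] f) := by
  induction n with
  | zero => exact hf
  | succ n ih => rw [Function.iterate_succ_apply']; exact measurable_transfer ih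

/-- Fubini: the leftmost factor `B 0` is integrated first, which is the innermost application of
`transfer`. -/
theorem lintegral_orderedProd_mul [SigmaFinite μ] (hf : Measurable f) (n : ℕ)
    (X : Matrix (Fin d) (Fin d) ℝ) :
    ∫⁻ B, f (orderedProd B * X) ∂(Measure.pi fun _ : Fin n => μ) = (transfer μ)^[n] f X := by
  induction n generalizing f with
  | zero =>
    rw [Measure.pi_of_empty, lintegral_dirac]
    simp [orderedProd]
  | succ n ih =>
    rw [Function.iterate_succ_apply, ← ih (measurable_transfer hf),
      ← (measurePreserving_piFinSuccAbove (fun _ => μ) 0).symm.lintegral_comp_emb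
        (MeasurableEquiv.measurableEmbedding _)]
    rw [lintegral_prod_symm]
    · refine lintegral_congr fun B => lintegral_congr fun A => ?_
      rw [← mul_assoc, ← orderedProd_cons]
      simp [MeasurableEquiv.piFinSuccAbove_symm_apply, Fin.insertNthEquiv, Fin.insertNth_zero']
    · refine Measurable.aemeasurable ?_
      exact hf.comp (((measurable_orderedProd _).comp (MeasurableEquiv.measurable _)).mul_const _)

end MatrixPressure

/-! ### Largest norms of products and the joint spectral radius -/

namespace MatrixPressure

variable {d : ℕ}

theorem orderedProd_mem_pow {A : Set (Matrix (Fin d) (Fin d) ℝ)} {n : ℕ}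
    {B : Fin n → Matrix (Fin d) (Fin d) ℝ} (hB : ∀ i, B i ∈ A) : orderedProd B ∈ A ^ n :=
  Set.mem_pow.2 ⟨fun i => ⟨B i, hB i⟩, rfl⟩

theorem exists_orderedProd_eq_of_mem_pow {A : Set (Matrix (Fin d) (Fin d) ℝ)} {n : ℕ}
    {P : Matrix (Fin d) (Fin d) ℝ} (hP : P ∈ A ^ n) :
    ∃ B : Fin n → Matrix (Fin d) (Fin d) ℝ, (∀ i, B i ∈ A) ∧ orderedProd B = P := by
  obtain ⟨B, rfl⟩ := Set.mem_pow.1 hP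
  exact ⟨fun i => B i, fun i => (B i).2, rfl⟩

/-- `X ↦ ‖X‖ ^ s` with values in `[0, ∞]`. -/
noncomputable def normPow (s : ℝ) (X : Matrix (Fin d) (Fin d) ℝ) : ENNReal :=
  ENNReal.ofReal (‖X‖ ^ s)

theorem normPow_smul {s : ℝ} (c : ℝ) (X : Matrix (Fin d) (Fin d) ℝ) :
    normPow s (c • X) = ENNReal.ofReal (|c| ^ s) * normPow s X := by
  rw [normPow, normPow, norm_smul, Real.mul_rpow (norm_nonneg _) (norm_nonneg _),
    ENNReal.ofReal_mul (by positivity), Real.norm_eq_abs]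

theorem normPow_mul_le {s : ℝ} (hs : 0 < s) (P X : Matrix (Fin d) (Fin d) ℝ) :
    normPow s (P * X) ≤ normPow s P * normPow s X := by
  rw [normPow, normPow, normPow, ← ENNReal.ofReal_mul (by positivity),
    ← Real.mul_rpow (norm_nonneg _) (norm_nonneg _)]
  exact ENNReal.ofReal_le_ofReal (Real.rpow_le_rpow (norm_nonneg _) (norm_mul_le _ _) hs.le)

theorem continuous_normPow {s : ℝ} (hs : 0 < s) :
    Continuous (normPow s : Matrix (Fin d) (Fin d) ℝ → ENNReal) :=
  ENNReal.continuous_ofReal.comp (continuous_norm.rpow_const fun _ => Or.inr hs.le)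

/-- The supremum of the norms of the products of `n` elements of `A`. -/
noncomputable def supNorm (A : Set (Matrix (Fin d) (Fin d) ℝ)) (n : ℕ) : ENNReal :=
  ⨆ P ∈ A ^ n, ENNReal.ofReal ‖P‖

theorem le_supNorm {A : Set (Matrix (Fin d) (Fin d) ℝ)} {n : ℕ} {P : Matrix (Fin d) (Fin d) ℝ}
    (hP : P ∈ A ^ n) : ENNReal.ofReal ‖P‖ ≤ supNorm A n :=
  le_iSup₂ (f := fun (P : Matrix (Fin d) (Fin d) ℝ) (_ : P ∈ A ^ n) => ENNReal.ofReal ‖P‖) P hP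

theorem supNorm_le {A : Set (Matrix (Fin d) (Fin d) ℝ)} {n : ℕ} {c : ℝ}
    (h : ∀ P ∈ A ^ n, ‖P‖ ≤ c) : supNorm A n ≤ ENNReal.ofReal c :=
  iSup₂_le fun P hP => ENNReal.ofReal_le_ofReal (h P hP)

theorem supNorm_add_le (A : Set (Matrix (Fin d) (Fin d) ℝ)) (m n : ℕ) :
    supNorm A (m + n) ≤ supNorm A m * supNorm A n := by
  refine iSup₂_le fun P hP => ?_
  rw [pow_add] at hP
  obtain ⟨Q, hQ, R, hR, rfl⟩ := Set.mem_mul.1 hP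
  calc ENNReal.ofReal ‖Q * R‖ ≤ ENNReal.ofReal (‖Q‖ * ‖R‖) :=
        ENNReal.ofReal_le_ofReal (norm_mul_le _ _)
    _ = ENNReal.ofReal ‖Q‖ * ENNReal.ofReal ‖R‖ := ENNReal.ofReal_mul (norm_nonneg _)
    _ ≤ _ := mul_le_mul' (le_supNorm hQ) (le_supNorm hR)

theorem exists_norm_le_of_mem_pow {A : Set (Matrix (Fin d) (Fin d) ℝ)} (hA : IsCompact A)
    (n : ℕ) : ∃ M, ∀ P ∈ A ^ n, ‖P‖ ≤ M := by
  obtain ⟨b, hb⟩ := hA.exists_bound_of_continuousOn (f := id) continuousOn_id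
  induction n with
  | zero => exact ⟨‖(1 : Matrix (Fin d) (Fin d) ℝ)‖, by simp⟩
  | succ n ih =>
    obtain ⟨M, hM⟩ := ih
    refine ⟨M * b, fun P hP => ?_⟩
    rw [pow_succ] at hP
    obtain ⟨Q, hQ, R, hR, rfl⟩ := Set.mem_mul.1 hP
    exact (norm_mul_le _ _).trans
      (mul_le_mul (hM Q hQ) (hb R hR) (norm_nonneg _) ((norm_nonneg _).trans (hM Q hQ)))

theorem supNorm_ne_top {A : Set (Matrix (Fin d) (Fin d) ℝ)} (hA : IsCompact A) (n : ℕ) :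
    supNorm A n ≠ ⊤ := by
  obtain ⟨M, hM⟩ := exists_norm_le_of_mem_pow hA n
  exact ((supNorm_le hM).trans_lt ENNReal.ofReal_lt_top).ne

theorem jointRadiusSeq_eq {A : Set (Matrix (Fin d) (Fin d) ℝ)} (hA : IsCompact A) {n : ℕ}
    (hn : n ≠ 0) : jointRadiusSeq A n = (supNorm A n ^ (1 / (n : ℝ))).toReal := by
  rw [← ENNReal.toReal_rpow, jointRadiusSeq]
  set T : Set ℝ := {r : ℝ | ∃ B : Fin n → Matrix (Fin d) (Fin d) ℝ,
    (∀ i, B i ∈ A) ∧ r = ‖orderedProd B‖ ^ (1 / (n : ℝ))}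
  have hub : ∀ r ∈ T, r ≤ (supNorm A n).toReal ^ (1 / (n : ℝ)) := by
    rintro _ ⟨B, hB, rfl⟩
    refine Real.rpow_le_rpow (norm_nonneg _) ?_ (by positivity)
    exact (ENNReal.ofReal_le_iff_le_toReal (supNorm_ne_top hA n)).1
      (le_supNorm (orderedProd_mem_pow hB))
  have hT0 : 0 ≤ sSup T := by
    refine Real.sSup_nonneg ?_
    rintro _ ⟨B, hB, rfl⟩
    positivity
  refine le_antisymm (Real.sSup_le hub (by positivity)) ?_
  have h1 : supNorm A n ≤ ENNReal.ofReal (sSup T ^ n) := by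
    refine supNorm_le fun P hP => ?_
    obtain ⟨B, hB, rfl⟩ := exists_orderedProd_eq_of_mem_pow hP
    have : ‖orderedProd B‖ ^ (1 / (n : ℝ)) ≤ sSup T := le_csSup ⟨_, hub⟩ ⟨B, hB, rfl⟩
    calc ‖orderedProd B‖ = (‖orderedProd B‖ ^ (1 / (n : ℝ))) ^ n := by
          rw [one_div, Real.rpow_inv_natCast_pow (norm_nonneg _) hn]
      _ ≤ sSup T ^ n := by gcongr
  have h2 : (supNorm A n).toReal ≤ sSup T ^ n :=
    ENNReal.toReal_le_of_le_ofReal (by positivity) h1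
  calc (supNorm A n).toReal ^ (1 / (n : ℝ)) ≤ (sSup T ^ n) ^ (1 / (n : ℝ)) := by gcongr
    _ = sSup T := by rw [one_div, Real.pow_rpow_inv_natCast hT0 hn]

/-- The joint spectral radius as an infimum in `[0, ∞]`. -/
noncomputable def supNormRate (A : Set (Matrix (Fin d) (Fin d) ℝ)) : ENNReal :=
  ⨅ n : ℕ, ⨅ _ : n ≠ 0, supNorm A n ^ (1 / (n : ℝ))

theorem supNormRate_ne_top {A : Set (Matrix (Fin d) (Fin d) ℝ)} (hA : IsCompact A) :
    supNormRate A ≠ ⊤ :=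
  ((iInf₂_le 1 one_ne_zero).trans_lt
    (ENNReal.rpow_lt_top_of_nonneg (by positivity) (supNorm_ne_top hA 1))).ne

theorem tendsto_jointRadiusSeq {A : Set (Matrix (Fin d) (Fin d) ℝ)} (hA : IsCompact A) :
    Tendsto (jointRadiusSeq A) atTop (𝓝 (supNormRate A).toReal) := by
  have h := ENNReal.tendsto_rpow_inv_of_submultiplicative (supNorm_add_le A) (supNorm_ne_top hA)
  refine ((ENNReal.tendsto_toReal (supNormRate_ne_top hA)).comp h).congr' ?_
  filter_upwards [eventually_ne_atTop 0] with n hn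
  exact (jointRadiusSeq_eq hA hn).symm

/-! ### Norm integrals and trace integrals -/

variable [MeasurableSpace (Matrix (Fin d) (Fin d) ℝ)] [BorelSpace (Matrix (Fin d) (Fin d) ℝ)]
  {μ : Measure (Matrix (Fin d) (Fin d) ℝ)}

theorem measurable_normPow {s : ℝ} (hs : 0 < s) :
    Measurable (normPow s : Matrix (Fin d) (Fin d) ℝ → ENNReal) :=
  (continuous_normPow hs).measurable

theorem normIntegral_eq_iterate_transfer [SigmaFinite μ] {s : ℝ} (hs : 0 < s) (n : ℕ) :
    normIntegral μ s n = (transfer μ)^[n] (normPow s) 1 := by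
  simp_rw [← lintegral_orderedProd_mul (measurable_normPow hs), mul_one]
  rfl

theorem iterate_transfer_normPow_le [SigmaFinite μ] {s : ℝ} (hs : 0 < s) (n : ℕ)
    (X : Matrix (Fin d) (Fin d) ℝ) :
    (transfer μ)^[n] (normPow s) X ≤ normIntegral μ s n * normPow s X := by
  rw [← lintegral_orderedProd_mul (measurable_normPow hs), normIntegral,
    ← lintegral_mul_const' _ _ (by rw [normPow]; exact ENNReal.ofReal_ne_top)]
  exact lintegral_mono fun B => normPow_mul_le hs _ _

theorem normIntegral_add_le [SigmaFinite μ] {s : ℝ} (hs : 0 < s)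
    (hfin : ∀ n, normIntegral μ s n ≠ ⊤) (m n : ℕ) :
    normIntegral μ s (m + n) ≤ normIntegral μ s m * normIntegral μ s n := by
  rw [normIntegral_eq_iterate_transfer hs, Function.iterate_add_apply,
    ← lintegral_orderedProd_mul (measurable_iterate_transfer (measurable_normPow hs) n)]
  simp_rw [mul_one]
  refine (lintegral_mono fun B => iterate_transfer_normPow_le hs n _).trans_eq ?_
  rw [lintegral_const_mul' _ _ (hfin n), mul_comm]
  rfl

theorem normIntegral_le_supNorm [IsFiniteMeasure μ] {s : ℝ} (hs : 0 < s) (n : ℕ) :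
    normIntegral μ s n ≤ supNorm μ.support n ^ s * μ Set.univ ^ n := by
  have hae : ∀ᵐ B ∂(Measure.pi fun _ : Fin n => μ), ∀ i, B i ∈ μ.support :=
    ae_all_iff.2 fun i =>
      (Measure.quasiMeasurePreserving_eval (fun _ : Fin n => μ) i).ae Measure.support_mem_ae
  calc normIntegral μ s n
      ≤ ∫⁻ _, supNorm μ.support n ^ s ∂(Measure.pi fun _ : Fin n => μ) := by
        refine lintegral_mono_ae (hae.mono fun B hB => ?_)
        rw [← ENNReal.ofReal_rpow_of_nonneg (norm_nonneg _) hs.le]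
        exact ENNReal.rpow_le_rpow (le_supNorm (orderedProd_mem_pow hB)) hs.le
    _ = _ := by simp [Measure.pi_univ]

/-- If `∫ ‖A₁ ⋯ A_k‖ ^ s ≤ L ^ k` for one `k`, then there is an `s`-homogeneous function that
dominates `‖X‖ ^ s` and that the transfer operator increases by at most the factor `L`. -/
theorem exists_transfer_le [SigmaFinite μ] {s : ℝ} (hs : 0 < s)
    (hfin : ∀ n, normIntegral μ s n ≠ ⊤) {L : ENNReal} (hL0 : L ≠ 0) (hL : L ≠ ⊤) {k : ℕ}
    (hk : k ≠ 0) (hkL : normIntegral μ s k ≤ L ^ k) :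
    ∃ F : Matrix (Fin d) (Fin d) ℝ → ENNReal, Measurable F ∧ (∀ X, F X ≠ ⊤) ∧
      (∀ (c : ℝ) X, F (c • X) = ENNReal.ofReal (|c| ^ s) * F X) ∧ (∀ X, normPow s X ≤ F X) ∧
      ∀ X, transfer μ F X ≤ L * F X := by
  have hmeas := fun n => measurable_iterate_transfer (μ := μ) (measurable_normPow (d := d) hs) n
  -- Applying L⁻¹ `transfer` shifts this sum by one: the term n = 0, ‖X‖^s, is exchanged for the
  -- term n = k, which is no larger by `hkL`.
  refine ⟨fun X => ∑ n ∈ Finset.range k, L⁻¹ ^ n * (transfer μ)^[n] (normPow s) X,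
    Finset.measurable_sum _ fun n _ => (hmeas n).const_mul _, fun X => ?_, fun c X => ?_,
    fun X => ?_, fun X => ?_⟩
  · refine ENNReal.sum_ne_top.2 fun n _ => ENNReal.mul_ne_top (by finiteness) ?_
    exact ((iterate_transfer_normPow_le hs n X).trans_lt
      (ENNReal.mul_lt_top (hfin n).lt_top ENNReal.ofReal_lt_top)).ne
  · rw [Finset.mul_sum]
    refine Finset.sum_congr rfl fun n _ => ?_
    rw [iterate_transfer_smul ENNReal.ofReal_ne_top n (normPow_smul c), mul_left_comm]
  · obtain ⟨k, rfl⟩ := Nat.exists_eq_succ_of_ne_zero hk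
    simp [Finset.sum_range_succ']
  · have h1 : transfer μ (fun X => ∑ n ∈ Finset.range k, L⁻¹ ^ n * (transfer μ)^[n] (normPow s) X)
        X = L * ∑ n ∈ Finset.range k, L⁻¹ ^ (n + 1) * (transfer μ)^[n + 1] (normPow s) X := by
      rw [transfer, lintegral_finsetSum, Finset.mul_sum]
      swap
      · exact fun n _ => ((hmeas n).comp (measurable_id.mul_const X)).const_mul _
      refine Finset.sum_congr rfl fun n _ => ?_
      rw [lintegral_const_mul' _ _ (by finiteness), Function.iterate_succ_apply', pow_succ',
        mul_assoc, ← mul_assoc L, ENNReal.mul_inv_cancel hL0 hL, one_mul]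
      rfl
    rw [h1]
    refine mul_le_mul_right ?_ _
    obtain ⟨k, rfl⟩ := Nat.exists_eq_succ_of_ne_zero hk
    beta_reduce
    rw [Finset.sum_range_succ, Finset.sum_range_succ' _ k]
    refine add_le_add_right ?_ _
    simp only [pow_zero, one_mul, Function.iterate_zero, id]
    calc L⁻¹ ^ (k + 1) * (transfer μ)^[k + 1] (normPow s) X
        ≤ L⁻¹ ^ (k + 1) * (L ^ (k + 1) * normPow s X) := by
          refine mul_le_mul_right ?_ _
          exact (iterate_transfer_normPow_le hs _ X).trans (mul_le_mul_left hkL _)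
      _ = normPow s X := by
          rw [← mul_assoc, ← mul_pow, ENNReal.inv_mul_cancel hL0 hL, one_pow, one_mul]

/-- The Auerbach bound for F is integrated and `transfer μ F ≤ L F` is iterated n times. The
constant depends neither on k nor on n, and its s-th root stays bounded as s → ∞. -/
theorem lintegral_abs_trace_rpow_le [SigmaFinite μ] {s : ℝ} (hs : 0 < s)
    (hfin : ∀ n, normIntegral μ s n ≠ ⊤) {L : ENNReal} (hL0 : L ≠ 0) (hL : L ≠ ⊤) {k : ℕ}
    (hk : k ≠ 0) (hkL : normIntegral μ s k ≤ L ^ k) (n : ℕ) :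
    ∫⁻ B, ENNReal.ofReal (|(orderedProd B).trace| ^ s) ∂(Measure.pi fun _ : Fin n => μ) ≤
      ENNReal.ofReal ((2 * d) ^ s) * (d * L ^ n) := by
  obtain ⟨F, hF, hFtop, hFhom, hFnorm, hFL⟩ := exists_transfer_le hs hfin hL0 hL hk hkL
  obtain ⟨V, hV, hVtr⟩ := exists_abs_trace_rpow_le (d := d) hs
    (φ := fun x => (F (Matrix.replicateCol (Fin d) x)).toReal)
    (fun c x => by
      rw [Matrix.replicateCol_smul, hFhom, ENNReal.toReal_mul, ENNReal.toReal_ofReal (by positivity)])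
    (fun x => by
      rw [← ENNReal.ofReal_le_iff_le_toReal (hFtop _)]
      refine le_trans (ENNReal.ofReal_le_ofReal ?_) (hFnorm _)
      exact Real.rpow_le_rpow (norm_nonneg _) (Matrix.norm_le_norm_replicateCol x) hs.le)
  have hpt : ∀ B : Fin n → Matrix (Fin d) (Fin d) ℝ,
      ENNReal.ofReal (|(orderedProd B).trace| ^ s) ≤ ENNReal.ofReal ((2 * d) ^ s) *
        ∑ i, F (orderedProd B * Matrix.replicateCol (Fin d) (V i)) := fun B => by
    refine (ENNReal.ofReal_le_ofReal (hVtr _)).trans_eq ?_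
    rw [ENNReal.ofReal_mul (by positivity), ENNReal.ofReal_sum_of_nonneg fun _ _ =>
      ENNReal.toReal_nonneg]
    simp_rw [ENNReal.ofReal_toReal (hFtop _), Matrix.replicateCol_mulVec]
  refine (lintegral_mono hpt).trans ?_
  rw [lintegral_const_mul' _ _ ENNReal.ofReal_ne_top, lintegral_finsetSum]
  swap
  · exact fun i _ => hF.comp ((measurable_orderedProd n).mul_const _)
  refine mul_le_mul_right ?_ _
  refine (Finset.sum_le_card_nsmul _ _ (L ^ n) fun i _ => ?_).trans_eq (by simp)
  rw [lintegral_orderedProd_mul hF]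
  refine (iterate_transfer_le_of_transfer_le hL hFL n _).trans ?_
  have : F (Matrix.replicateCol (Fin d) (V i)) ≤ 1 := by
    rw [← ENNReal.ofReal_toReal (hFtop _), ← ENNReal.ofReal_one]
    exact ENNReal.ofReal_le_ofReal (hV i)
  exact (mul_le_mul_right this _).trans_eq (mul_one _)

end MatrixPressure

/-! ### The zero-temperature limit -/

theorem MeasureTheory.Measure.pi_pos_of_mem_nhds_of_mem_support {ι X : Type*} [Fintype ι]
    [TopologicalSpace X] [MeasurableSpace X] {μ : Measure X} [SigmaFinite μ] {x : ι → X}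
    (hx : ∀ i, x i ∈ μ.support) {U : Set (ι → X)} (hU : U ∈ 𝓝 x) :
    0 < Measure.pi (fun _ : ι => μ) U := by
  rw [nhds_pi, Filter.mem_pi] at hU
  obtain ⟨I, -, t, ht, htU⟩ := hU
  have h1 : Set.univ.pi t ⊆ U := (Set.pi_mono' (fun _ _ => subset_rfl) (Set.subset_univ I)).trans htU
  refine lt_of_lt_of_le ?_ (measure_mono h1)
  rw [Measure.pi_pi, CanonicallyOrderedAdd.prod_pos]
  exact fun i _ => (Measure.mem_support_iff_forall _).1 (hx i) _ (ht i)

theorem EReal.exp_log_div (x : ENNReal) (s : ℝ) :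
    EReal.exp (ENNReal.log x / (s : EReal)) = x ^ s⁻¹ := by
  rw [div_eq_mul_inv, ← EReal.coe_inv, EReal.exp_mul, ENNReal.exp_log]

namespace MatrixPressure

variable {d : ℕ} [MeasurableSpace (Matrix (Fin d) (Fin d) ℝ)]
  {μ : Measure (Matrix (Fin d) (Fin d) ℝ)}

/-- The limit of `(∫ ‖A₁ ⋯ Aₙ‖ ^ s) ^ (1 / n)`. -/
noncomputable def integralRate (μ : Measure (Matrix (Fin d) (Fin d) ℝ)) (s : ℝ) : ENNReal :=
  ⨅ n : ℕ, ⨅ _ : n ≠ 0, normIntegral μ s n ^ (1 / (n : ℝ))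

theorem integralRate_ne_top {s : ℝ} (hfin : ∀ n, normIntegral μ s n ≠ ⊤) :
    integralRate μ s ≠ ⊤ :=
  ((iInf₂_le 1 one_ne_zero).trans_lt
    (ENNReal.rpow_lt_top_of_nonneg (by positivity) (hfin 1))).ne

variable [BorelSpace (Matrix (Fin d) (Fin d) ℝ)]

/-- If `∫ ‖A₁ ⋯ A_k‖ ^ s ≤ r ^ (s k)` with some `k = k(s)` for arbitrarily large `s`, then traces of
products of `n` elements of the support are bounded by a multiple of `r ^ n`. -/
theorem abs_trace_le_of_frequently [SigmaFinite μ]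
    (hfin : ∀ s : ℝ, 0 < s → ∀ n, normIntegral μ s n ≠ ⊤) {r : ℝ} (hr : 0 < r)
    (h : ∃ᶠ s : ℝ in atTop, ∃ k : ℕ, k ≠ 0 ∧ normIntegral μ s k ≤ ENNReal.ofReal (r ^ s) ^ k)
    (n : ℕ) (P : Matrix (Fin d) (Fin d) ℝ) (hP : P ∈ μ.support ^ n) :
    |P.trace| ≤ (2 * d + 1) * r ^ n := by
  obtain ⟨B, hB, rfl⟩ := exists_orderedProd_eq_of_mem_pow hP
  by_contra! hlt
  obtain ⟨a, hKa, hat⟩ := exists_between hlt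
  -- Using 2d + 1 rather than 2d keeps q positive when d = 0.
  set q := (2 * d + 1) * r ^ n
  have hq : 0 < q := by positivity
  have ha : 0 < a := hq.trans hKa
  -- U has positive measure, while Markov's inequality bounds that measure by d (q / a)^s, which
  -- tends to 0.
  set U : Set (Fin n → Matrix (Fin d) (Fin d) ℝ) := {B' | a < |(orderedProd B').trace|}
  have hUo : IsOpen U :=
    isOpen_lt continuous_const (continuous_orderedProd n).matrix_trace.abs
  have hUpos := Measure.pi_pos_of_mem_nhds_of_mem_support hB (hUo.mem_nhds (x := B) hat)
  have hlim : Tendsto (fun s : ℝ => (d : ENNReal) * ENNReal.ofReal ((q / a) ^ s)) atTop (𝓝 0) := by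
    have h1 := tendsto_rpow_atTop_of_base_lt_one (q / a)
      (by linarith [div_pos hq ha]) ((div_lt_one ha).2 hKa)
    have h2 := ENNReal.Tendsto.const_mul (a := (d : ENNReal)) (ENNReal.tendsto_ofReal h1)
      (Or.inr (ENNReal.natCast_ne_top d))
    simpa using h2
  obtain ⟨s, ⟨k, hk, hkL⟩, hs, hsU⟩ :=
    (h.and_eventually ((eventually_gt_atTop 0).and (hlim.eventually_lt_const hUpos))).exists
  refine hsU.not_ge ?_
  have hL0 : ENNReal.ofReal (r ^ s) ≠ 0 := (ENNReal.ofReal_pos.2 (by positivity)).ne'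
  have h1 := lintegral_abs_trace_rpow_le hs (hfin s hs) hL0 ENNReal.ofReal_ne_top hk hkL n
  have h2 : ENNReal.ofReal (a ^ s) * Measure.pi (fun _ : Fin n => μ) U ≤
      ∫⁻ B, ENNReal.ofReal (|(orderedProd B).trace| ^ s) ∂(Measure.pi fun _ : Fin n => μ) := by
    rw [← setLIntegral_const]
    refine le_trans (setLIntegral_mono' hUo.measurableSet fun B' hB' => ?_)
      (setLIntegral_le_lintegral U _)
    exact ENNReal.ofReal_le_ofReal (Real.rpow_le_rpow ha.le (le_of_lt hB') hs.le)
  have h3 : ENNReal.ofReal ((2 * d) ^ s) * (d * ENNReal.ofReal (r ^ s) ^ n) ≤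
      ENNReal.ofReal (a ^ s) * (d * ENNReal.ofReal ((q / a) ^ s)) := by
    rw [mul_left_comm, mul_left_comm (ENNReal.ofReal (a ^ s)),
      ← ENNReal.ofReal_pow (by positivity), ← ENNReal.ofReal_mul (by positivity),
      ← ENNReal.ofReal_mul (by positivity), ← Real.mul_rpow ha.le (by positivity),
      mul_div_cancel₀ _ ha.ne', ← Real.rpow_natCast (r ^ s), ← Real.rpow_mul hr.le, mul_comm s,
      Real.rpow_mul hr.le, Real.rpow_natCast, ← Real.mul_rpow (by positivity) (by positivity)]
    gcongr
    simp only [q]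
    gcongr
    linarith
  have h4 := (h2.trans h1).trans h3
  exact (ENNReal.mul_le_mul_iff_right (ENNReal.ofReal_pos.2 (by positivity)).ne'
    ENNReal.ofReal_ne_top).1 h4

theorem tendsto_pressureSeq [SigmaFinite μ] {s : ℝ} (hs : 0 < s)
    (hfin : ∀ n, normIntegral μ s n ≠ ⊤) :
    Tendsto (pressureSeq μ s) atTop (𝓝 (ENNReal.log (integralRate μ s))) := by
  have h := ENNReal.tendsto_rpow_inv_of_submultiplicative (normIntegral_add_le hs hfin) hfin
  refine ((ENNReal.continuous_log.tendsto _).comp h).congr fun n => ?_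
  exact ENNReal.log_rpow

/-- An infimum below r^s is witnessed by a single k, so traces on the support grow at rate at most
r, and hence so do norms. -/
theorem supNormRate_le_of_frequently [IsFiniteMeasure μ] (hA : IsCompact μ.support)
    (hfin : ∀ s : ℝ, 0 < s → ∀ n, normIntegral μ s n ≠ ⊤) {r : ℝ} (hr : 0 < r)
    (h : ∃ᶠ s : ℝ in atTop, integralRate μ s < ENNReal.ofReal (r ^ s)) :
    supNormRate μ.support ≤ ENNReal.ofReal r := by
  have h' : ∃ᶠ s : ℝ in atTop, ∃ k : ℕ, k ≠ 0 ∧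
      normIntegral μ s k ≤ ENNReal.ofReal (r ^ s) ^ k := by
    refine h.mono fun s hs => ?_
    simp only [integralRate, iInf_lt_iff] at hs
    obtain ⟨k, hk, hlt⟩ := hs
    refine ⟨k, hk, ?_⟩
    rw [← ENNReal.rpow_natCast, ← ENNReal.rpow_inv_le_iff (by positivity), ← one_div]
    exact hlt.le
  rw [← ENNReal.ofReal_toReal (supNormRate_ne_top hA)]
  refine ENNReal.ofReal_le_ofReal (le_of_forall_abs_trace_le
    (fun n P hP => abs_trace_le_of_frequently hfin hr h' n P hP) hr
    (exists_norm_le_of_mem_pow hA) fun n hn c hc hPc => ?_)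
  rw [← ENNReal.toReal_pow]
  refine ENNReal.toReal_le_of_le_ofReal hc (le_trans ?_ (supNorm_le hPc))
  rw [← ENNReal.rpow_natCast, ← ENNReal.le_rpow_inv_iff (by positivity), ← one_div]
  exact iInf₂_le n hn

theorem integralRate_rpow_inv_le [IsFiniteMeasure μ] {s : ℝ} (hs : 0 < s) {n : ℕ} (hn : n ≠ 0) :
    integralRate μ s ^ s⁻¹ ≤ supNorm μ.support n ^ (1 / (n : ℝ)) * μ Set.univ ^ s⁻¹ := by
  have hn' : (n : ℝ) ≠ 0 := Nat.cast_ne_zero.2 hn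
  calc integralRate μ s ^ s⁻¹
      ≤ ((supNorm μ.support n ^ s * μ Set.univ ^ n) ^ (1 / (n : ℝ))) ^ s⁻¹ := by
        refine ENNReal.rpow_le_rpow ((iInf₂_le n hn).trans ?_) (by positivity)
        exact ENNReal.rpow_le_rpow (normIntegral_le_supNorm hs n) (by positivity)
    _ = _ := by
        rw [← ENNReal.rpow_natCast, ← ENNReal.rpow_mul,
          ENNReal.mul_rpow_of_nonneg _ _ (by positivity), ← ENNReal.rpow_mul, ← ENNReal.rpow_mul]
        congr 2 <;> field_simp

theorem tendsto_integralRate_rpow_inv [IsFiniteMeasure μ] (hA : IsCompact μ.support)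
    (hfin : ∀ s : ℝ, 0 < s → ∀ n, normIntegral μ s n ≠ ⊤) :
    Tendsto (fun s : ℝ => integralRate μ s ^ s⁻¹) atTop (𝓝 (supNormRate μ.support)) := by
  refine tendsto_order.2 ⟨fun a ha => ?_, fun b hb => ?_⟩
  · by_contra hcon
    have hfreq : ∃ᶠ s : ℝ in atTop, integralRate μ s ^ s⁻¹ ≤ a := by
      simpa only [not_eventually, not_lt] using hcon
    obtain ⟨r, -, har, hr⟩ := ENNReal.lt_iff_exists_real_btwn.1 ha
    have hr0 : 0 < r := ENNReal.ofReal_pos.1 (bot_le.trans_lt har)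
    refine hr.not_ge (supNormRate_le_of_frequently hA hfin hr0 ?_)
    refine (hfreq.and_eventually (eventually_gt_atTop 0)).mono fun s hs => ?_
    rw [← ENNReal.ofReal_rpow_of_pos hr0, ← ENNReal.rpow_inv_lt_iff hs.2]
    exact hs.1.trans_lt har
  · simp only [supNormRate, iInf_lt_iff] at hb
    obtain ⟨n, hn, hb⟩ := hb
    -- The maximum with 1 gives a positive base, whose power s⁻¹ tends to 1 even if μ = 0.
    have hm : 0 < max 1 (μ Set.univ).toReal := by positivity
    have h1 : Tendsto (fun s : ℝ => ENNReal.ofReal (max 1 (μ Set.univ).toReal ^ s⁻¹)) atTop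
        (𝓝 1) := by
      have := ((Real.continuous_const_rpow hm.ne').tendsto 0).comp
        (tendsto_inv_atTop_zero (𝕜 := ℝ))
      rw [Real.rpow_zero] at this
      simpa using ENNReal.tendsto_ofReal this
    have h2 := ENNReal.Tendsto.const_mul (a := supNorm μ.support n ^ (1 / (n : ℝ))) h1
      (Or.inl one_ne_zero)
    rw [mul_one] at h2
    filter_upwards [h2.eventually_lt_const hb, eventually_gt_atTop 0] with s hs hs0
    refine ((integralRate_rpow_inv_le hs0 hn).trans ?_).trans_lt hs
    refine mul_le_mul_right ?_ _
    rw [← ENNReal.ofReal_rpow_of_pos hm]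
    refine ENNReal.rpow_le_rpow ?_ (by positivity)
    rw [← ENNReal.ofReal_toReal (measure_ne_top μ Set.univ)]
    exact ENNReal.ofReal_le_ofReal (by simp)

end MatrixPressure

/-- The first three conjuncts say that the limits defining the pressure `M(μ, s)` and the joint
spectral radius exist (and that `M(μ, s) < ∞`); the last one is the zero-temperature limit
`e ^ (M(μ, s) / s) → ϱ_∞(A)`, with `e ^ (-∞) = 0`. -/
theorem mainTheorem7 (d : ℕ)
    [MeasurableSpace (Matrix (Fin d) (Fin d) ℝ)] [BorelSpace (Matrix (Fin d) (Fin d) ℝ)]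
    (A : Set (Matrix (Fin d) (Fin d) ℝ)) (hA : IsCompact A)
    (μ : Measure (Matrix (Fin d) (Fin d) ℝ)) [IsFiniteMeasure μ] (hμ : μ.support = A) :
    (∀ s : ℝ, 0 < s → (∫⁻ B, ENNReal.ofReal (‖B‖ ^ s) ∂μ) < ⊤ ∧ MatrixPressure.normPressure μ s < ⊤ ∧
      Tendsto (MatrixPressure.pressureSeq μ s) atTop (𝓝 (MatrixPressure.normPressure μ s))) ∧
    Tendsto (MatrixPressure.jointRadiusSeq A) atTop (𝓝 (MatrixPressure.jointSpectralRadius A)) ∧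
    Tendsto (fun s : ℝ => EReal.exp (MatrixPressure.normPressure μ s / (s : EReal))) atTop
      (𝓝 (ENNReal.ofReal (MatrixPressure.jointSpectralRadius A))) := by
  subst hμ
  have hfin : ∀ s : ℝ, 0 < s → ∀ n, MatrixPressure.normIntegral μ s n ≠ ⊤ := fun s hs n =>
    ((MatrixPressure.normIntegral_le_supNorm hs n).trans_lt (ENNReal.mul_lt_top
      (ENNReal.rpow_lt_top_of_nonneg hs.le (MatrixPressure.supNorm_ne_top hA n))
      (ENNReal.pow_lt_top (measure_lt_top μ _)))).ne
  have hM : ∀ s : ℝ, 0 < s →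
      MatrixPressure.normPressure μ s = ENNReal.log (MatrixPressure.integralRate μ s) :=
    fun s hs => (MatrixPressure.tendsto_pressureSeq hs (hfin s hs)).limUnder_eq
  have hJ := MatrixPressure.tendsto_jointRadiusSeq hA
  have hJe : MatrixPressure.jointSpectralRadius μ.support =
      (MatrixPressure.supNormRate μ.support).toReal := hJ.limUnder_eq
  refine ⟨fun s hs => ⟨?_, ?_, ?_⟩, ?_, ?_⟩
  · have h1 := MatrixPressure.normIntegral_eq_iterate_transfer (μ := μ) hs 1
    simp only [Function.iterate_one, MatrixPressure.transfer, mul_one] at h1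
    exact lt_top_iff_ne_top.2 fun htop => hfin s hs 1 (h1.trans htop)
  · rw [hM s hs, lt_top_iff_ne_top, Ne, ENNReal.log_eq_top_iff]
    exact MatrixPressure.integralRate_ne_top (hfin s hs)
  · rw [hM s hs]
    exact MatrixPressure.tendsto_pressureSeq hs (hfin s hs)
  · rw [hJe]
    exact hJ
  · rw [hJe, ENNReal.ofReal_toReal (MatrixPressure.supNormRate_ne_top hA)]
    refine (MatrixPressure.tendsto_integralRate_rpow_inv hA hfin).congr' ?_
    filter_upwards [eventually_gt_atTop 0] with s hs
    rw [hM s hs, EReal.exp_log_div]
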